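/- Let $n\ge 3$, and identify a simple graph on the vertex set $[n]=\{1,\dots,n\}$ with its set of edges, a subset of $\binom{[n]}{2}$. A graph $G$ on $[n]$ is called $i$-connected ($0<i<n$) if deleting any set of fewer than $i$ vertices from $G$ leaves a connected graph. Let $\Delta_n^{n-2}$ be the simplicial complex, with vertex set $\binom{[n]}{2}$, whose faces are the edge sets of the graphs on $[n]$ that are not $(n-2)$-connected, and let $M_n$ (the matching complex) be the simplicial complex, with vertex set $\binom{[n]}{2}$, whose faces are the edge sets of the graphs on $[n]$ that are matchings (no vertex lies on two different edges). In both complexes the empty set is allowed as a face. For a simplicial complex $K$ on a finite vertex set $V$, its Alexander dual is $K^*=\{B\subseteq V \mid V\setminus B\notin K\}$. Then a graph $G$ on $[n]$ is $(n-2)$-connected if and only if its complement is a matching. Consequently $M_n$ and $\Delta_n^{n-2}$ are Alexander dual to each other: $$(M_n)^*=\Delta_n^{n-2},\qquad (\Delta_n^{n-2})^*=M_n .$$ Moreover, for every $i\in\mathbb Z$ there is an isomorphism of abelian groups $$\widetilde H_i(M_n)\;\cong\;\widetilde H^{\binom n2-i-3}(\Delta_n^{n-2}),$$ where $\widetilde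 H_*$ and $\widetilde H^*$ denote reduced simplicial homology and cohomology with integer coefficients. -/

import Mathlib

namespace GraphComplex

noncomputable section

/-! ### Simplicial complexes on a vertex set `V` and their reduced (co)homology

A finite simplicial complex on the vertex set `V`, with the empty set allowed as a face, is a
family of finite subsets of `V` that is closed under passing to subsets: `LowerSet (Finset V)`. -/

section Homology

variable {V : Type*} [LinearOrder V]

/-- The `i`-dimensional faces of `K`, i.e. those with `i + 1` elements. The empty face has
dimension `-1`. -/
abbrev Face (K : LowerSet (Finset V)) (i : ℤ) : Type _ :=
  {s : Finset V // s ∈ K ∧ (s.card : ℤ) = i + 1}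

/-- The augmented simplicial chain group in degree `i`, with integer coefficients. -/
abbrev Chain (K : LowerSet (Finset V)) (i : ℤ) : Type _ := Face K i →₀ ℤ

/-- The facet of `s` obtained by deleting the vertex `v`. -/
def Face.erase {K : LowerSet (Finset V)} {i j : ℤ} (h : j + 1 = i) (s : Face K i)
    (v : {v // v ∈ s.1}) : Face K j :=
  ⟨s.1.erase v.1, K.lower (Finset.erase_subset _ _) s.2.1, by
    have h1 := Finset.card_erase_add_one v.2
    have h2 := s.2.2
    omega⟩

/-- The incidence sign of `v` in `s`: if `v = v_k` where `s = {v_0 < v_1 < ... < v_i}`,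
it is `(-1) ^ k`. -/
def sign (s : Finset V) (v : V) : ℤ := (-1) ^ (s.filter (· < v)).card

/-- The boundary map `∂ : C_i → C_j`, for `i = j + 1`, which sends the face
`{v_0 < ... < v_i}` to the alternating sum of its facets. -/
def boundary (K : LowerSet (Finset V)) (i j : ℤ) (h : j + 1 = i) : Chain K i →ₗ[ℤ] Chain K j :=
  Finsupp.linearCombination ℤ fun s : Face K i =>
    ∑ v : {v // v ∈ s.1}, Finsupp.single (Face.erase h s v) (sign s.1 v.1)

lemma sign_mul_sign_erase {s : Finset V} {v w : V} (hv : v ∈ s) (hw : w ∈ s) (hvw : v ≠ w) :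
    sign s v * sign (s.erase v) w = -(sign s w * sign (s.erase w) v) := by
  wlog h : v < w generalizing v w
  · rw [this hw hv hvw.symm (lt_of_le_of_ne (not_lt.mp h) hvw.symm), neg_neg]
  have h1 : (s.erase w).filter (· < v) = s.filter (· < v) := by
    ext x
    simp only [Finset.mem_filter, Finset.mem_erase]
    exact ⟨fun hx => ⟨hx.1.2, hx.2⟩, fun hx => ⟨⟨(hx.2.trans h).ne, hx.1⟩, hx.2⟩⟩
  have h2 : ((s.erase v).filter (· < w)).card + 1 = (s.filter (· < w)).card := by
    rw [Finset.filter_erase]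
    exact Finset.card_erase_add_one (Finset.mem_filter.mpr ⟨hv, h⟩)
  unfold sign
  rw [h1, ← h2, pow_succ]
  ring

/-- Boundaries are cycles: `∂ ∘ ∂ = 0`. -/
lemma boundary_comp_boundary (K : LowerSet (Finset V)) (i j k : ℤ) (h : j + 1 = i)
    (h' : k + 1 = j) : boundary K j k h' ∘ₗ boundary K i j h = 0 := by
  refine Finsupp.lhom_ext' fun s => LinearMap.ext_ring ?_
  simp only [LinearMap.comp_apply, Finsupp.lsingle_apply, boundary,
    Finsupp.linearCombination_single, one_smul, map_sum, LinearMap.zero_apply, Finset.smul_sum,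
    Finsupp.smul_single, smul_eq_mul]
  rw [Finset.sum_sigma']
  refine Finset.sum_involution
    (fun p _ => ⟨⟨p.2.1, Finset.mem_of_mem_erase p.2.2⟩,
      ⟨p.1.1, Finset.mem_erase.mpr ⟨(Finset.ne_of_mem_erase p.2.2).symm, p.1.2⟩⟩⟩)
    ?_ ?_ (fun _ _ => by simp) (fun _ _ => rfl)
  · rintro ⟨v, w⟩ -
    have hf : Face.erase h' (Face.erase h s v) w =
        Face.erase h' (Face.erase h s ⟨w.1, Finset.mem_of_mem_erase w.2⟩)
          ⟨v.1, Finset.mem_erase.mpr ⟨(Finset.ne_of_mem_erase w.2).symm, v.2⟩⟩ :=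
      Subtype.ext Finset.erase_right_comm
    have hs := sign_mul_sign_erase v.2 (Finset.mem_of_mem_erase w.2)
      (Finset.ne_of_mem_erase w.2).symm
    dsimp only
    rw [hf, ← Finsupp.single_add]
    refine (congrArg _ ?_).trans (Finsupp.single_zero _)
    simp only [Face.erase]
    rw [hs]
    ring
  · rintro ⟨v, w⟩ - - hp
    exact Finset.ne_of_mem_erase w.2 (congrArg (fun p => p.1.1) hp)

/-- Reduced simplicial homology `H̃_i(K)` with integer coefficients:
cycles modulo boundaries. -/
abbrev ReducedHomology (K : LowerSet (Finset V)) (i : ℤ) : Type _ :=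
  LinearMap.ker (boundary K i (i - 1) (sub_add_cancel i 1)) ⧸
    (LinearMap.range (boundary K (i + 1) i rfl)).submoduleOf
      (LinearMap.ker (boundary K i (i - 1) (sub_add_cancel i 1)))

/-- The augmented simplicial cochain group `Hom(C_i, ℤ)`. -/
abbrev Cochain (K : LowerSet (Finset V)) (i : ℤ) : Type _ := Module.Dual ℤ (Chain K i)

/-- The coboundary map `δ : C^j → C^i`, for `i = j + 1`: the transpose of the boundary map. -/
def coboundary (K : LowerSet (Finset V)) (j i : ℤ) (h : j + 1 = i) :
    Cochain K j →ₗ[ℤ] Cochain K i :=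
  (boundary K i j h).dualMap

/-- Reduced simplicial cohomology `H̃^i(K)` with integer coefficients:
cocycles modulo coboundaries. -/
abbrev ReducedCohomology (K : LowerSet (Finset V)) (i : ℤ) : Type _ :=
  LinearMap.ker (coboundary K i (i + 1) rfl) ⧸
    (LinearMap.range (coboundary K (i - 1) i (sub_add_cancel i 1))).submoduleOf
      (LinearMap.ker (coboundary K i (i + 1) rfl))

end Homology

/-- The combinatorial Alexander dual `K* = {B ⊆ V | V \ B ∉ K}`. -/
def alexanderDual {V : Type*} [Fintype V] [DecidableEq V] (K : LowerSet (Finset V)) :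
    LowerSet (Finset V) where
  carrier := {B | Bᶜ ∉ K}
  lower' := fun _ _ hCB hB hC => hB (K.lower (Finset.compl_subset_compl.mpr hCB) hC)

/-! ### Graphs on `n` vertices and complexes of graphs -/

/-- The edges of the complete graph on the vertex set `Fin n`. -/
abbrev Edge (n : ℕ) : Type := {e : Sym2 (Fin n) // ¬ e.IsDiag}

lemma edge_toLex_injective (n : ℕ) :
    Function.Injective fun e : Edge n => toLex (e.1.inf, e.1.sup) := by
  intro e f h
  have h' : (e.1.inf, e.1.sup) = (f.1.inf, f.1.sup) := toLex.injective h
  rw [Prod.mk.injEq] at h'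
  exact Subtype.ext (Sym2.inf_eq_inf_and_sup_eq_sup.mp h')

/-- The lexicographic order on edges: `{a < b}` is compared as the pair `(a, b)`. -/
instance edgeLinearOrder (n : ℕ) : LinearOrder (Edge n) :=
  { LinearOrder.lift' (fun e : Edge n => toLex (e.1.inf, e.1.sup)) (edge_toLex_injective n) with
    toDecidableEq := inferInstance
    compare_eq_compareOfLessAndEq := fun a b => by
      convert (LinearOrder.lift' (fun e : Edge n => toLex (e.1.inf, e.1.sup))
        (edge_toLex_injective n)).compare_eq_compareOfLessAndEq a b }

/-- The graph on the vertex set `Fin n` with edge set `B`. -/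
def graphOfEdges {n : ℕ} (B : Finset (Edge n)) : SimpleGraph (Fin n) :=
  SimpleGraph.fromEdgeSet (Subtype.val '' (B : Set (Edge n)))

lemma graphOfEdges_mono {n : ℕ} {B C : Finset (Edge n)} (h : B ⊆ C) :
    graphOfEdges B ≤ graphOfEdges C :=
  SimpleGraph.fromEdgeSet_mono (Set.image_mono (Finset.coe_subset.mpr h))

/-- `G` is `i`-connected (meant for `0 < i < |V|`): deleting any set of fewer than `i` vertices
leaves a graph in which any two vertices are joined by a path. -/
def IsVertexConnected {V : Type*} (G : SimpleGraph V) (i : ℕ) : Prop :=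
  ∀ S : Finset V, S.card < i → (G.induce {v | v ∉ S}).Preconnected

/-- `G` is a (partial) matching: no vertex lies on two different edges. -/
def IsMatchingGraph {V : Type*} (G : SimpleGraph V) : Prop :=
  ∀ v w w' : V, G.Adj v w → G.Adj v w' → w = w'

/-- `Δ_n^i`: the complex of (edge sets of) not `i`-connected graphs on `n` vertices. -/
def notConnectedComplex (n i : ℕ) : LowerSet (Finset (Edge n)) where
  carrier := {B | ¬ IsVertexConnected (graphOfEdges B) i}
  lower' := fun _ _ hCB hB hC => hB fun S hS =>
    (hC S hS).mono (SimpleGraph.comap_monotone _ (graphOfEdges_mono hCB))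

/-- `M_n`: the complex of (edge sets of) matchings on `n` vertices. -/
def matchingComplex (n : ℕ) : LowerSet (Finset (Edge n)) where
  carrier := {B | IsMatchingGraph (graphOfEdges B)}
  lower' := fun _ _ hCB hB v w w' h h' =>
    hB v w w' (graphOfEdges_mono hCB h) (graphOfEdges_mono hCB h')

end

end GraphComplex

/-! If a vertex has two non-neighbours, deleting everything but these three vertices, `n - 3` in
all, isolates it. If every vertex has at most one, a surviving third vertex joins any two
non-adjacent ones. This gives the graph criterion, hence both dualities of complexes.

For homology, let `L` be the Alexander dual of `K` on `N` vertices. Its faces are the complements of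
the nonfaces of `K`, so cochains of `L` are chains of the full simplex modulo chains of `K`. The
twist by `shuffleSign` turns the coboundary into the boundary (`coboundary_dualCochain`), so
`H̃^{N-i-3}(L)` is the relative homology of (simplex, `K`) in degree `i + 1`. The simplex is acyclic
(`simplexBoundary_cone_add`), so the connecting map identifies this with `H̃_i(K)`. Instead of
forming the relative complex, the proof maps the relative cycles `R` onto both sides and compares
kernels through `nonempty_subquotient_equiv`. -/

namespace GraphComplex

section Duality

/-- Two subquotients `Z / B` and `Z' / B'` are isomorphic as soon as a submodule `R` of a common
module maps onto both `Z` and `Z'`, and the preimages of `B` and `B'` in `R` agree. -/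
lemma nonempty_subquotient_equiv {A M N N' : Type*} [Ring A] [AddCommGroup M] [AddCommGroup N]
    [AddCommGroup N'] [Module A M] [Module A N] [Module A N'] (R : Submodule A M)
    (f : M →ₗ[A] N) (g : M →ₗ[A] N') {Z B : Submodule A N} {Z' B' : Submodule A N'}
    (hf : R.map f = Z) (hg : R.map g = Z') (h : ∀ x ∈ R, f x ∈ B ↔ g x ∈ B') :
    Nonempty ((Z ⧸ B.submoduleOf Z) ≃ₗ[A] (Z' ⧸ B'.submoduleOf Z')) := by
  have hfm : ∀ x ∈ R, f x ∈ Z := fun x hx => hf ▸ Submodule.mem_map_of_mem hx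
  have hgm : ∀ x ∈ R, g x ∈ Z' := fun x hx => hg ▸ Submodule.mem_map_of_mem hx
  let F : R →ₗ[A] Z ⧸ B.submoduleOf Z := (B.submoduleOf Z).mkQ ∘ₗ f.restrict hfm
  let G : R →ₗ[A] Z' ⧸ B'.submoduleOf Z' := (B'.submoduleOf Z').mkQ ∘ₗ g.restrict hgm
  have hF : Function.Surjective F := by
    refine (Submodule.mkQ_surjective _).comp ?_
    rintro ⟨z, hz⟩
    obtain ⟨x, hx, rfl⟩ := Submodule.mem_map.mp (hf ▸ hz)
    exact ⟨⟨x, hx⟩, rfl⟩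
  have hG : Function.Surjective G := by
    refine (Submodule.mkQ_surjective _).comp ?_
    rintro ⟨z, hz⟩
    obtain ⟨x, hx, rfl⟩ := Submodule.mem_map.mp (hg ▸ hz)
    exact ⟨⟨x, hx⟩, rfl⟩
  have hk : LinearMap.ker F = LinearMap.ker G := by
    ext x
    have h1 : F x = 0 ↔ f x ∈ B := Submodule.Quotient.mk_eq_zero _
    have h2 : G x = 0 ↔ g x ∈ B' := Submodule.Quotient.mk_eq_zero _
    rw [LinearMap.mem_ker, LinearMap.mem_ker, h1, h2, h x.1 x.2]
  exact ⟨(F.quotKerEquivOfSurjective hF).symm ≪≫ₗ Submodule.quotEquivOfEq _ _ hk ≪≫ₗ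
    G.quotKerEquivOfSurjective hG⟩

/-! ### Chains of `K` as functions on all finite sets -/

variable {V : Type*}

open Classical in
/-- Extension of a chain of `K` by zero. -/
noncomputable def extendChain (K : LowerSet (Finset V)) (i : ℤ) (b : Chain K i) : Finset V → ℤ :=
  fun s => if h : s ∈ K ∧ (s.card : ℤ) = i + 1 then b ⟨s, h⟩ else 0

variable {K : LowerSet (Finset V)}

lemma extendChain_face {i : ℤ} (b : Chain K i) (s : Face K i) : extendChain K i b s.1 = b s :=
  dif_pos s.2

lemma extendChain_of_not {i : ℤ} (b : Chain K i) {s : Finset V}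
    (h : ¬(s ∈ K ∧ (s.card : ℤ) = i + 1)) : extendChain K i b s = 0 :=
  dif_neg h

variable (K) in
/-- The chain of `K` obtained by restricting a function on all finite sets to the faces. -/
noncomputable def restrictChain [Fintype V] (i : ℤ) : (Finset V → ℤ) →ₗ[ℤ] Chain K i where
  toFun c := Finsupp.equivFunOnFinite.symm fun s => c s.1
  map_add' _ _ := by ext; simp
  map_smul' _ _ := by ext; simp

lemma restrictChain_extendChain [Fintype V] {i : ℤ} (b : Chain K i) :
    restrictChain K i (extendChain K i b) = b :=
  Finsupp.ext fun s => extendChain_face b s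

lemma extendChain_restrictChain [Fintype V] {i : ℤ} {c : Finset V → ℤ}
    (hc : ∀ s, ¬(s ∈ K ∧ (s.card : ℤ) = i + 1) → c s = 0) :
    extendChain K i (restrictChain K i c) = c := by
  ext s
  by_cases h : s ∈ K ∧ (s.card : ℤ) = i + 1
  · exact extendChain_face _ ⟨s, h⟩
  · rw [extendChain_of_not _ h, hc s h]

variable [LinearOrder V]

/-! ### The full simplex and its contraction -/

lemma sign_mul_self (s : Finset V) (v : V) : sign s v * sign s v = 1 := by
  unfold sign
  rw [← mul_pow]
  simp

/-- The cone with apex `a`. -/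
def cone (a : V) (c : Finset V → ℤ) : Finset V → ℤ :=
  fun s => if a ∈ s then c (s.erase a) else 0

lemma cone_eq_zero_of_card {a : V} {c : Finset V → ℤ} {k : ℤ}
    (hc : ∀ s : Finset V, (s.card : ℤ) ≠ k → c s = 0) {s : Finset V}
    (hs : (s.card : ℤ) ≠ k + 1) : cone a c s = 0 := by
  unfold cone
  split_ifs with ha
  · apply hc
    have := Finset.card_erase_add_one ha
    omega
  · rfl

variable [Fintype V]

/-- The boundary map of the full simplex on `V`, on all functions on the set of faces. -/
def simplexBoundary : (Finset V → ℤ) →ₗ[ℤ] (Finset V → ℤ) where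
  toFun c s := ∑ v, if v ∈ s then 0 else sign (insert v s) v * c (insert v s)
  map_add' c d := by
    ext s
    simp only [Pi.add_apply, ← Finset.sum_add_distrib]
    refine Finset.sum_congr rfl fun v _ => ?_
    split_ifs <;> ring
  map_smul' a c := by
    ext s
    simp only [Pi.smul_apply, smul_eq_mul, RingHom.id_apply, Finset.mul_sum]
    refine Finset.sum_congr rfl fun v _ => ?_
    split_ifs <;> ring

lemma simplexBoundary_apply (c : Finset V → ℤ) (s : Finset V) :
    simplexBoundary c s = ∑ v, if v ∈ s then 0 else sign (insert v s) v * c (insert v s) := rfl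

/-- Adding two vertices in either order gives opposite signs, so the double sum is antisymmetric and
equals its own negative. -/
lemma simplexBoundary_simplexBoundary (c : Finset V → ℤ) :
    simplexBoundary (simplexBoundary c) = 0 := by
  ext s
  let a : V → V → ℤ := fun v w => if v ∈ s ∨ w ∈ insert v s then 0 else
    sign (insert v s) v * (sign (insert w (insert v s)) w * c (insert w (insert v s)))
  have h1 : simplexBoundary (simplexBoundary c) s = ∑ v, ∑ w, a v w := by
    simp only [simplexBoundary_apply]
    refine Finset.sum_congr rfl fun v _ => ?_
    by_cases hv : v ∈ s
    · simp [a, hv]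
    · simp only [a, hv, if_false, false_or, Finset.mul_sum, mul_ite, mul_zero]
  have ha : ∀ v w, a v w = -a w v := by
    intro v w
    by_cases hv : v ∈ s
    · simp [a, hv]
    by_cases hw : w ∈ s
    · simp [a, hw]
    by_cases hvw : v = w
    · subst hvw
      simp [a]
    have h := sign_mul_sign_erase (s := insert w (insert v s)) (v := v) (w := w)
      (by simp) (by simp) hvw
    have e1 : (insert w (insert v s)).erase w = insert v s :=
      Finset.erase_insert (by simp [hw, Ne.symm hvw])
    have e2 : (insert w (insert v s)).erase v = insert w s := by
      rw [Finset.insert_comm]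
      exact Finset.erase_insert (by simp [hv, hvw])
    rw [e1, e2] at h
    simp only [a, hv, hw, hvw, Ne.symm hvw, Finset.mem_insert, or_self, if_false]
    rw [Finset.insert_comm v w s]
    linear_combination c (insert w (insert v s)) * h
  have h2 : ∑ v, ∑ w, a v w = -∑ v, ∑ w, a v w := by
    conv_lhs => rw [Finset.sum_comm]
    rw [← Finset.sum_neg_distrib]
    refine Finset.sum_congr rfl fun v _ => ?_
    rw [← Finset.sum_neg_distrib]
    exact Finset.sum_congr rfl fun w _ => ha w v
  rw [h1, Pi.zero_apply]
  omega

/-- Coning off a least vertex contracts the full simplex. -/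
lemma simplexBoundary_cone_add {a : V} (ha : ∀ v, a ≤ v) (c : Finset V → ℤ) :
    simplexBoundary (cone a c) + cone a (simplexBoundary c) = c := by
  have hsa : ∀ s, sign s a = 1 := by
    intro s
    have : s.filter (· < a) = ∅ := Finset.filter_false_of_mem fun v _ => not_lt.mpr (ha v)
    simp [sign, this]
  ext s
  rw [Pi.add_apply]
  by_cases hs : a ∈ s
  · have hc : cone a (simplexBoundary c) s = simplexBoundary c (s.erase a) := if_pos hs
    -- In the merged sum the term at `a` is `c s`; every other vertex contributes a cancelling pair,
    -- since inserting `v` before or after removing `a` flips the sign.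
    rw [hc, simplexBoundary_apply, simplexBoundary_apply, ← Finset.sum_add_distrib,
      Finset.sum_eq_single a]
    · simp [hs, hsa]
    · intro v _ hva
      by_cases hv : v ∈ s
      · simp [hv, hva]
      · have h1 : (insert v s).erase a = insert v (s.erase a) :=
          Finset.erase_insert_of_ne hva
        have h2 : sign (insert v (s.erase a)) v = -sign (insert v s) v := by
          have h := sign_mul_sign_erase (s := insert v s) (v := a) (w := v)
            (by simp [hs]) (by simp) hva.symm
          rwa [hsa, hsa, h1, one_mul, mul_one] at h
        simp [hv, hva, cone, hs, h1, h2]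
    · simp
  · have hc : cone a (simplexBoundary c) s = 0 := if_neg hs
    rw [hc, simplexBoundary_apply, add_zero, Finset.sum_eq_single a]
    · simp [hs, hsa, cone]
    · intro v _ hva
      simp [cone, hs, hva.symm]
    · simp

lemma simplexBoundary_eq_zero_of_card {c : Finset V → ℤ} {k : ℤ}
    (hc : ∀ s : Finset V, (s.card : ℤ) ≠ k + 1 → c s = 0) {s : Finset V}
    (hs : (s.card : ℤ) ≠ k) : simplexBoundary c s = 0 := by
  rw [simplexBoundary_apply]
  refine Finset.sum_eq_zero fun v _ => ?_
  split_ifs with hv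
  · rfl
  · rw [hc, mul_zero]
    rw [Finset.card_insert_of_notMem hv]
    push_cast
    omega

lemma boundary_apply {i j : ℤ} (h : j + 1 = i) (b : Chain K i) (t : Face K j) :
    boundary K i j h b t = simplexBoundary (extendChain K i b) t.1 := by
  induction b using Finsupp.induction_linear with
  | zero =>
    have h0 : extendChain K i 0 = 0 := by
      ext s
      by_cases hs : s ∈ K ∧ (s.card : ℤ) = i + 1
      · exact extendChain_face _ ⟨s, hs⟩
      · exact extendChain_of_not _ hs
    simp [h0]
  | add b c hb hc =>
    have h0 : extendChain K i (b + c) = extendChain K i b + extendChain K i c := by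
      ext s
      by_cases hs : s ∈ K ∧ (s.card : ℤ) = i + 1
      · simp [extendChain, hs]
      · simp [extendChain, hs]
    simp [h0, hb, hc]
  | single s a =>
    have he : ∀ r, extendChain K i (Finsupp.single s a) r = if r = s.1 then a else 0 := by
      intro r
      by_cases hr : r = s.1
      · subst hr
        rw [extendChain_face, if_pos rfl, Finsupp.single_eq_same]
      · rw [if_neg hr]
        by_cases hs : r ∈ K ∧ (r.card : ℤ) = i + 1
        · refine (extendChain_face _ ⟨r, hs⟩).trans (Finsupp.single_eq_of_ne ?_)
          exact fun e => hr (congrArg Subtype.val e)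
        · exact extendChain_of_not _ hs
    have h1 : boundary K i j h (Finsupp.single s a) t =
        ∑ v : {v // v ∈ s.1}, if s.1.erase v.1 = t.1 then a * sign s.1 v.1 else 0 := by
      simp only [boundary, Finsupp.linearCombination_single, Finsupp.smul_apply,
        Finsupp.finsetSum_apply, smul_eq_mul, Finset.mul_sum]
      refine Finset.sum_congr rfl fun v _ => ?_
      rw [Finsupp.single_apply]
      simp only [Subtype.ext_iff, Face.erase, mul_ite, mul_zero]
    rw [h1, simplexBoundary_apply, Finset.sum_coe_sort s.1
      (fun v => if s.1.erase v = t.1 then a * sign s.1 v else 0), ← Finset.sum_subset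
      (Finset.subset_univ s.1)]
    · refine Finset.sum_congr rfl fun v hv => ?_
      rw [he]
      by_cases hvt : s.1.erase v = t.1
      · have h2 : insert v t.1 = s.1 := by rw [← hvt, Finset.insert_erase hv]
        have h3 : v ∉ t.1 := by simp [← hvt]
        rw [if_pos hvt, if_neg h3, h2, if_pos rfl, mul_comm]
      · rw [if_neg hvt]
        split_ifs with h3 h4
        · rfl
        · exact absurd (by rw [← h4, Finset.erase_insert h3]) hvt
        · rw [mul_zero]
    · intro v _ hv
      rw [he, if_neg (c := insert v t.1 = s.1), mul_zero, ite_self]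
      exact fun e => hv (e ▸ Finset.mem_insert_self v t.1)

/-- Since `K` is closed under subsets, no boundary term leaves `K`: extension by zero is a chain map
into the simplex. -/
lemma extendChain_boundary {i j : ℤ} (h : j + 1 = i) (b : Chain K i) :
    extendChain K j (boundary K i j h b) = simplexBoundary (extendChain K i b) := by
  ext s
  by_cases hs : s ∈ K ∧ (s.card : ℤ) = j + 1
  · rw [← boundary_apply h b ⟨s, hs⟩]
    exact extendChain_face _ ⟨s, hs⟩
  · rw [extendChain_of_not _ hs, simplexBoundary_apply]
    refine (Finset.sum_eq_zero fun v _ => ?_).symm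
    split_ifs with hv
    · rfl
    · rw [extendChain_of_not, mul_zero]
      rintro ⟨h1, h2⟩
      refine hs ⟨K.lower (Finset.subset_insert v s) h1, ?_⟩
      rw [Finset.card_insert_of_notMem hv] at h2
      push_cast at h2
      omega

/-! ### Passing to complements -/

/-- The sign of the shuffle which compares a set with its complement. -/
def shuffleSign (s : Finset V) : ℤ := ∏ v ∈ s, sign Finset.univ v

lemma shuffleSign_mul_self (s : Finset V) : shuffleSign s * shuffleSign s = 1 := by
  simp [shuffleSign, ← Finset.prod_mul_distrib, sign_mul_self]

/-- The vertices below `v` are split between `s` and its complement, so the exponents add up. -/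
lemma sign_insert_mul_sign_compl {s : Finset V} {v : V} (hv : v ∉ s) :
    sign (insert v s) v * sign sᶜ v = sign Finset.univ v := by
  unfold sign
  rw [← pow_add, ← Finset.card_union_of_disjoint]
  · congr 2
    ext x
    simp only [Finset.mem_union, Finset.mem_filter, Finset.mem_insert, Finset.mem_compl,
      Finset.mem_univ, true_and]
    tauto
  · rw [Finset.disjoint_left]
    simp only [Finset.mem_filter, Finset.mem_insert, Finset.mem_compl]
    rintro x ⟨rfl | h1, h2⟩ ⟨h3, _⟩
    · exact lt_irrefl _ h2
    · exact h3 h1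

lemma shuffleSign_insert {s : Finset V} {v : V} (hv : v ∉ s) :
    sign sᶜ v * shuffleSign (insert v s) = shuffleSign s * sign (insert v s) v := by
  have h1 : shuffleSign (insert v s) = sign Finset.univ v * shuffleSign s :=
    Finset.prod_insert hv
  rw [h1, ← sign_insert_mul_sign_compl hv]
  linear_combination (sign (insert v s) v * shuffleSign s) * sign_mul_self sᶜ v

variable (K) in
/-- A function on all finite sets, read on complements of faces, as a cochain. -/
noncomputable def dualCochain (j : ℤ) : (Finset V → ℤ) →ₗ[ℤ] Cochain K j where
  toFun c := Finsupp.linearCombination ℤ fun t : Face K j => shuffleSign t.1ᶜ * c t.1ᶜ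
  map_add' _ _ := by
    refine Finsupp.lhom_ext' fun s => LinearMap.ext_ring ?_
    simp [mul_add]
  map_smul' _ _ := by
    refine Finsupp.lhom_ext' fun s => LinearMap.ext_ring ?_
    simp [mul_left_comm]

lemma dualCochain_single (j : ℤ) (c : Finset V → ℤ) (t : Face K j) :
    dualCochain K j c (Finsupp.single t 1) = shuffleSign t.1ᶜ * c t.1ᶜ := by
  simp [dualCochain]

lemma dualCochain_eq_zero_iff {j : ℤ} {c : Finset V → ℤ} :
    dualCochain K j c = 0 ↔ ∀ t : Face K j, c t.1ᶜ = 0 := by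
  constructor
  · intro h t
    have h1 := dualCochain_single j c t
    rw [h, LinearMap.zero_apply] at h1
    linear_combination (-shuffleSign t.1ᶜ) * h1 - c t.1ᶜ * shuffleSign_mul_self t.1ᶜ
  · intro h
    refine Finsupp.lhom_ext' fun t => LinearMap.ext_ring ?_
    simp only [LinearMap.comp_apply, Finsupp.lsingle_apply, dualCochain_single, h t, mul_zero,
      LinearMap.zero_apply]

/-- Deleting `v` from `t` inserts it into the complement; `shuffleSign_insert` matches the two
incidence signs. -/
lemma coboundary_dualCochain {i j : ℤ} (h : j + 1 = i) (c : Finset V → ℤ) :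
    coboundary K j i h (dualCochain K j c) = dualCochain K i (simplexBoundary c) := by
  refine Finsupp.lhom_ext' fun t => LinearMap.ext_ring ?_
  simp only [LinearMap.comp_apply, Finsupp.lsingle_apply, dualCochain_single]
  simp only [coboundary, LinearMap.dualMap_apply, boundary, Finsupp.linearCombination_single,
    one_smul, map_sum]
  have h1 : ∀ v : {v // v ∈ t.1}, dualCochain K j c
      (Finsupp.single (Face.erase h t v) (sign t.1 v.1)) =
      shuffleSign t.1ᶜ * (sign (insert v.1 t.1ᶜ) v.1 * c (insert v.1 t.1ᶜ)) := by
    intro v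
    have h2 := shuffleSign_insert (s := t.1ᶜ) (v := v.1) (by simp [v.2])
    rw [compl_compl] at h2
    rw [← mul_one (sign t.1 v.1), ← smul_eq_mul, ← Finsupp.smul_single, map_smul,
      dualCochain_single, smul_eq_mul]
    simp only [Face.erase, Finset.compl_erase]
    linear_combination c (insert v.1 t.1ᶜ) * h2
  rw [Finset.sum_congr rfl fun v _ => h1 v, ← Finset.mul_sum, simplexBoundary_apply,
    Finset.sum_coe_sort t.1 (fun v => sign (insert v t.1ᶜ) v * c (insert v t.1ᶜ)), ← Finset.sum_subset (Finset.subset_univ t.1)]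
  · congr 1
    exact Finset.sum_congr rfl fun v hv => by simp [hv]
  · intro v _ hv
    simp [hv]

open Classical in
-- Signs are their own inverses, so undo the twist and extend by zero. The support condition makes
-- the lift homogeneous.
lemma exists_dualCochain_eq {j : ℤ} (φ : Cochain K j) :
    ∃ c : Finset V → ℤ, dualCochain K j c = φ ∧
      ∀ s : Finset V, (s.card : ℤ) ≠ Fintype.card V - j - 1 → c s = 0 := by
  refine ⟨fun s => if h : sᶜ ∈ K ∧ ((sᶜ).card : ℤ) = j + 1 then
    shuffleSign s * φ (Finsupp.single ⟨sᶜ, h⟩ 1) else 0, ?_, ?_⟩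
  · refine Finsupp.lhom_ext' fun t => LinearMap.ext_ring ?_
    simp only [LinearMap.comp_apply, Finsupp.lsingle_apply, dualCochain_single, compl_compl]
    rw [dif_pos t.2, ← mul_assoc, shuffleSign_mul_self, one_mul]
  · intro s hs
    refine dif_neg fun h => hs ?_
    have := Finset.card_compl_add_card s
    omega

/-! ### Alexander duality -/

/-- **Combinatorial Alexander duality**: if `L` is the Alexander dual of `K`, then
`H̃_i(K) ≅ H̃^{|V| - i - 3}(L)`. -/
theorem nonempty_reducedHomology_equiv_reducedCohomology [Nonempty V]
    (K L : LowerSet (Finset V)) (hL : ∀ B, B ∈ L ↔ Bᶜ ∉ K) {i j : ℤ}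
    (hij : j = Fintype.card V - i - 3) :
    Nonempty (ReducedHomology K i ≃ₗ[ℤ] ReducedCohomology L j) := by
  obtain ⟨a, -, ha'⟩ := Finset.exists_min_image (Finset.univ : Finset V) id Finset.univ_nonempty
  have ha : ∀ v, a ≤ v := fun v => ha' v (Finset.mem_univ v)
  have hcard : ∀ s : Finset V, ((sᶜ).card : ℤ) = Fintype.card V - s.card := by
    intro s
    have := Finset.card_compl_add_card s
    omega
  -- The kernel of `dualCochain L k` is "supported on `K`" in cardinality `l`: it is reduction
  -- modulo chains of `K`.
  have hzero : ∀ (k l : ℤ) (c : Finset V → ℤ), l = Fintype.card V - k - 1 →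
      (dualCochain L k c = 0 ↔ ∀ s, s ∉ K → (s.card : ℤ) = l → c s = 0) := by
    intro k l c hkl
    rw [dualCochain_eq_zero_iff]
    constructor
    · intro h s hs hsl
      have := h ⟨sᶜ, by rwa [hL, compl_compl], by rw [hcard]; omega⟩
      simpa using this
    · intro h t
      refine h _ ((hL _).mp t.2.1) ?_
      rw [hcard, t.2.2]
      omega
  -- Relative cycles: chains of dimension `i + 1`, hence on sets of `i + 2` vertices, whose boundary
  -- lies in `K`.
  let R : Submodule ℤ (Finset V → ℤ) :=
    { carrier := {c | (∀ s : Finset V, (s.card : ℤ) ≠ i + 1 + 1 → c s = 0) ∧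
        ∀ s, s ∉ K → simplexBoundary c s = 0}
      add_mem' := fun {c d} hc hd =>
        ⟨fun s hs => by simp [hc.1 s hs, hd.1 s hs], fun s hs => by simp [hc.2 s hs, hd.2 s hs]⟩
      zero_mem' := ⟨fun _ _ => rfl, fun _ _ => by simp⟩
      smul_mem' := fun m c hc =>
        ⟨fun s hs => by simp [hc.1 s hs], fun s hs => by
          rw [map_smul, Pi.smul_apply, hc.2 s hs, smul_zero]⟩ }
  have hR : ∀ c ∈ R, extendChain K i (restrictChain K i (simplexBoundary c)) =
      simplexBoundary c := by
    intro c hc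
    refine extendChain_restrictChain fun s hs => ?_
    by_cases hsK : s ∈ K
    · exact simplexBoundary_eq_zero_of_card hc.1 fun h => hs ⟨hsK, h⟩
    · exact hc.2 s hsK
  refine nonempty_subquotient_equiv R (restrictChain K i ∘ₗ simplexBoundary)
    (dualCochain L j) ?_ ?_ ?_
  · ext z
    simp only [Submodule.mem_map, LinearMap.comp_apply, LinearMap.mem_ker]
    constructor
    · rintro ⟨c, hc, rfl⟩
      rw [← restrictChain_extendChain (boundary K i (i - 1) _ _), extendChain_boundary, hR c hc,
        simplexBoundary_simplexBoundary, map_zero]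
    · intro hz
      have hz' : simplexBoundary (extendChain K i z) = 0 := by
        rw [← extendChain_boundary (sub_add_cancel i 1), hz]
        ext s
        by_cases hs : s ∈ K ∧ (s.card : ℤ) = i - 1 + 1
        · exact extendChain_face _ ⟨s, hs⟩
        · exact extendChain_of_not _ hs
      have hb : simplexBoundary (cone a (extendChain K i z)) = extendChain K i z := by
        have h := simplexBoundary_cone_add ha (extendChain K i z)
        have h0 : cone a (0 : Finset V → ℤ) = 0 := by
          ext s
          simp [cone]
        rwa [hz', h0, add_zero] at h
      -- A cycle of `K` bounds its cone in the simplex, and the cone is then a relative cycle.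
      refine ⟨cone a (extendChain K i z), ⟨fun s hs => cone_eq_zero_of_card ?_ hs, ?_⟩, ?_⟩
      · exact fun s hs => extendChain_of_not _ fun h => hs h.2
      · intro s hs
        rw [hb]
        exact extendChain_of_not _ fun h => hs h.1
      · rw [hb, restrictChain_extendChain]
  · ext φ
    simp only [Submodule.mem_map, LinearMap.mem_ker]
    constructor
    · rintro ⟨c, hc, rfl⟩
      rw [coboundary_dualCochain, hzero (j + 1) (i + 1) _ (by omega)]
      exact fun s hs _ => hc.2 s hs
    · intro hφ
      obtain ⟨c, rfl, hc⟩ := exists_dualCochain_eq φ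
      rw [coboundary_dualCochain, hzero (j + 1) (i + 1) _ (by omega)] at hφ
      have hc' : ∀ s : Finset V, (s.card : ℤ) ≠ i + 1 + 1 → c s = 0 :=
        fun s hs => hc s fun h => hs (by omega)
      refine ⟨c, ⟨hc', fun s hs => ?_⟩, rfl⟩
      by_cases hsi : (s.card : ℤ) = i + 1
      · exact hφ s hs hsi
      · exact simplexBoundary_eq_zero_of_card hc' hsi
  · intro x hx
    simp only [LinearMap.comp_apply, LinearMap.mem_range]
    constructor
    · rintro ⟨b, hb⟩
      have h1 : simplexBoundary (extendChain K (i + 1) b) = simplexBoundary x := by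
        rw [← extendChain_boundary rfl, hb, hR x hx]
      -- `x` and `b` have the same boundary, so their difference bounds its cone; modulo `K` this
      -- makes `x` itself a boundary.
      have h2 := simplexBoundary_cone_add ha (x - extendChain K (i + 1) b)
      have h0 : cone a (0 : Finset V → ℤ) = 0 := by
        ext s
        simp [cone]
      rw [map_sub simplexBoundary x, h1, sub_self, h0, add_zero] at h2
      refine ⟨dualCochain L (j - 1) (cone a (x - extendChain K (i + 1) b)), ?_⟩
      rw [coboundary_dualCochain, h2, map_sub, sub_eq_self,
        hzero j (i + 1 + 1) _ (by omega)]
      exact fun s hs _ => extendChain_of_not _ fun h => hs h.1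
    · rintro ⟨φ, hφ⟩
      obtain ⟨c, rfl, hc⟩ := exists_dualCochain_eq φ
      rw [coboundary_dualCochain, eq_comm, ← sub_eq_zero, ← map_sub,
        hzero j (i + 1 + 1) _ (by omega)] at hφ
      -- `x` agrees with the boundary of `c` off `K`, so the difference is a chain of `K` with the
      -- same boundary as `x`.
      refine ⟨restrictChain K (i + 1) (x - simplexBoundary c), ?_⟩
      rw [← restrictChain_extendChain (boundary K (i + 1) i _ _), extendChain_boundary,
        extendChain_restrictChain, map_sub, simplexBoundary_simplexBoundary, sub_zero]
      intro s hs
      by_cases hsi : (s.card : ℤ) = i + 1 + 1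
      · exact hφ s (fun h => hs ⟨h, hsi⟩) hsi
      · rw [Pi.sub_apply, hx.1 s hsi, simplexBoundary_eq_zero_of_card (k := i + 1 + 1) _ hsi,
          sub_zero]
        exact fun s hs => hc s fun h => hs (by omega)

end Duality

/-! ### Connectivity and matchings -/

/-- A graph on `n ≥ 3` vertices is `(n - 2)`-connected iff its complement is a matching. -/
theorem isVertexConnected_iff_isMatchingGraph_compl {n : ℕ} (hn : 3 ≤ n)
    (G : SimpleGraph (Fin n)) : IsVertexConnected G (n - 2) ↔ IsMatchingGraph Gᶜ := by
  constructor
  · intro h v w w' hw hw'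
    by_contra hne
    rw [SimpleGraph.compl_adj] at hw hw'
    have hc : ({v, w, w'} : Finset (Fin n)).card = 3 :=
      Finset.card_eq_three.mpr ⟨v, w, w', hw.1, hw'.1, hne, rfl⟩
    have hS : (({v, w, w'} : Finset (Fin n))ᶜ).card < n - 2 := by
      rw [Finset.card_compl, hc, Fintype.card_fin]
      omega
    obtain ⟨p⟩ := h _ hS ⟨v, by simp⟩ ⟨w, by simp⟩
    -- The first step of the walk already fails: `v` has no neighbour among the survivors `v`, `w`,
    -- `w'`.
    cases p with
    | nil => exact hw.1 rfl
    | @cons _ u _ hu _ =>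
      obtain ⟨u, hu'⟩ := u
      have hu : G.Adj v u := hu
      have hmem : u = v ∨ u = w ∨ u = w' := by
        simpa [or_iff_not_imp_left] using hu'
      rcases hmem with rfl | rfl | rfl
      · exact G.irrefl hu
      · exact hw.2 hu
      · exact hw'.2 hu
  · rintro h S hS ⟨u, hu⟩ ⟨v, hv⟩
    by_cases huv : u = v
    · subst huv
      exact SimpleGraph.Reachable.refl _
    by_cases hadj : G.Adj u v
    · exact SimpleGraph.Adj.reachable (G := G.induce {v | v ∉ S}) hadj
    -- At most `n - 3` vertices are deleted, so some `w` besides `u` and `v` survives; the matching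
    -- condition makes it adjacent to both.
    have hlt : (insert u (insert v S)).card < (Finset.univ : Finset (Fin n)).card := by
      have h1 := Finset.card_insert_le u (insert v S)
      have h2 := Finset.card_insert_le v S
      rw [Finset.card_univ, Fintype.card_fin]
      omega
    obtain ⟨w, -, hw⟩ := Finset.exists_mem_notMem_of_card_lt_card hlt
    simp only [Finset.mem_insert, not_or] at hw
    have huw : G.Adj u w := by
      by_contra hcon
      exact hw.2.1 (h u w v ⟨Ne.symm hw.1, hcon⟩ ⟨huv, hadj⟩)
    have hwv : G.Adj w v := by
      by_contra hcon
      exact hw.1 (h v w u ⟨Ne.symm hw.2.1, fun e => hcon e.symm⟩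
        ⟨Ne.symm huv, fun e => hadj e.symm⟩)
    exact (SimpleGraph.Adj.reachable (G := G.induce {v | v ∉ S}) (u := ⟨u, hu⟩)
      (v := ⟨w, hw.2.2⟩) huw).trans
      (SimpleGraph.Adj.reachable (G := G.induce {v | v ∉ S}) hwv)

lemma graphOfEdges_adj {n : ℕ} {B : Finset (Edge n)} {v w : Fin n} (h : v ≠ w) :
    (graphOfEdges B).Adj v w ↔ (⟨s(v, w), by simpa using h⟩ : Edge n) ∈ B := by
  simp [graphOfEdges, h]

lemma graphOfEdges_compl {n : ℕ} (B : Finset (Edge n)) :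
    graphOfEdges Bᶜ = (graphOfEdges B)ᶜ := by
  ext v w
  by_cases h : v = w
  · subst h
    simp
  · rw [SimpleGraph.compl_adj, graphOfEdges_adj h, graphOfEdges_adj h, Finset.mem_compl]
    simp [h]

lemma mem_notConnectedComplex_iff {n : ℕ} (hn : 3 ≤ n) (B : Finset (Edge n)) :
    B ∈ notConnectedComplex n (n - 2) ↔ Bᶜ ∉ matchingComplex n := by
  change ¬IsVertexConnected (graphOfEdges B) (n - 2) ↔ ¬IsMatchingGraph (graphOfEdges Bᶜ)
  rw [graphOfEdges_compl, isVertexConnected_iff_isMatchingGraph_compl hn]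

end GraphComplex

theorem mainTheorem9 (n : ℕ) (hn : 3 ≤ n) :
    (∀ G : SimpleGraph (Fin n),
      GraphComplex.IsVertexConnected G (n - 2) ↔ GraphComplex.IsMatchingGraph Gᶜ) ∧
    GraphComplex.alexanderDual (GraphComplex.matchingComplex n) =
      GraphComplex.notConnectedComplex n (n - 2) ∧
    GraphComplex.alexanderDual (GraphComplex.notConnectedComplex n (n - 2)) =
      GraphComplex.matchingComplex n ∧
    ∀ i : ℤ, Nonempty
      (GraphComplex.ReducedHomology (GraphComplex.matchingComplex n) i ≃ₗ[ℤ]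
        GraphComplex.ReducedCohomology (GraphComplex.notConnectedComplex n (n - 2))
          ((n.choose 2 : ℤ) - i - 3)) := by
  refine ⟨GraphComplex.isVertexConnected_iff_isMatchingGraph_compl hn, ?_, ?_, fun i => ?_⟩
  · ext B
    exact (GraphComplex.mem_notConnectedComplex_iff hn B).symm
  · ext B
    change Bᶜ ∉ GraphComplex.notConnectedComplex n (n - 2) ↔ B ∈ GraphComplex.matchingComplex n
    rw [GraphComplex.mem_notConnectedComplex_iff hn, not_not, compl_compl]
  · have hcard : Fintype.card (GraphComplex.Edge n) = n.choose 2 := by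
      rw [Sym2.card_subtype_not_diag, Fintype.card_fin]
    -- The contraction of the simplex needs an apex.
    have : Nonempty (GraphComplex.Edge n) := by
      rw [← Fintype.card_pos_iff, hcard]
      exact Nat.choose_pos (by omega)
    refine GraphComplex.nonempty_reducedHomology_equiv_reducedCohomology _ _ (fun B => ?_)
      (by rw [hcard])
    convert GraphComplex.mem_notConnectedComplex_iff hn B
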